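/- For integers $d\ge 1$ and $n\ge 0$, let the book graph $B_{d,n}$ be the graph obtained from the complete graph $K_d$ by adding $n$ pairwise nonadjacent vertices, each adjacent to every vertex of $K_d$. For a finite graph $G$, the hat-guessing number $\mathrm{HG}(G)$ is the largest integer $q$ for which the players win the following game: one player sits at each vertex, each gets a hat of one of $q$ colors, each player sees exactly the hats of the players at adjacent vertices, and, by a strategy fixed in advance (the guess at each vertex is a function of the colors on its neighbors), all players simultaneously guess their own hat color; the players win if for every assignment of hats at least one player guesses correctly. **Theorem.** For every $d\ge 1$ there is $N=N(d)$ such that for all $n\ge N$, $$\mathrm{HG}(B_{d,n}) = 1+\sum_{i=1}^{d} i^i ,$$ and moreover the minimum size $\tau(B_{d,n})$ of a vertex cover of $B_{d,n}$ equals $d$. In particular, the value $1+\sum_{i=1}^{\tau(G)} i^i$ of Gadouleau's upper bound for $\mathrm{HG}(G)$ is attained by a graph $G$ with $\tau(G)=d$, for every $d\ge1$. -/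

import Mathlib

/-- The book graph `B_{d,n}`: a clique on the spine `Fin d`, together with `n` pages `Fin n`,
pairwise nonadjacent and each adjacent to every spine vertex. -/
def bookGraph (d n : ℕ) : SimpleGraph (Fin d ⊕ Fin n) where
  Adj u v := u ≠ v ∧ (u.isLeft = true ∨ v.isLeft = true)
  symm := ⟨fun _ _ h => ⟨h.1.symm, h.2.symm⟩⟩
  loopless := ⟨fun _ h => h.1 rfl⟩

/-- A guessing strategy with `q` hat colours: the player at `v` guesses a colour as a function of
the colours of the hats at the neighbours of `v` only. -/
abbrev HatStrategy {V : Type*} (G : SimpleGraph V) (q : ℕ) : Type _ :=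
  (v : V) → (G.neighborSet v → Fin q) → Fin q

/-- The players on `G` can guarantee a win with `q` colours: some strategy makes at least one
player guess correctly, whatever the assignment of hats. -/
def HatWinnable {V : Type*} (G : SimpleGraph V) (q : ℕ) : Prop :=
  ∃ f : HatStrategy G q, ∀ c : V → Fin q, ∃ v : V, f v (fun w => c w) = c v

/-- `q` is the hat-guessing number of `G`: the largest number of colours for which the players
can guarantee a win. -/
def IsHatGuessingNumber {V : Type*} (G : SimpleGraph V) (q : ℕ) : Prop :=
  IsGreatest {k : ℕ | HatWinnable G k} q

/-! Put `s = ∑ i ^ i`. With enough pages, every function from spine colourings to colours is used by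
some page. Then, whatever the page hats, the spine colourings on which all pages err number at most
`s`: among `s + 1` of them one could label the points by the colours, and the page guessing that
label would be right somewhere. The spine must cover this set `T`, each player knowing all
coordinates but its own. By Hall's theorem this is possible once every subset is at most as large as
its coordinate projections together (`exists_guess_of_card_le`).

That inequality is isoperimetric. `card_sub_sum_card_coordProj_le` bounds the excess `|T| - ∑ |π_i
T|` by `maxExcess`: take a direction in which `T` has most slices and delete the smallest slice. The
projections in the other directions split additively, so everything reduces to the numerical
`maxExcess_slice_le`. Finally `maxExcess_nonpos` shows that the bound is not positive up to `s`.

Conversely, some `T` with `s + 1` points has positive excess (`exists_sum_card_coordProj_lt`). With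
more than `s + 1` colours each page has a hat colour it guesses nowhere on `T`, and the spine cannot
cover `T`. -/

/-! ### Near-cubes grown one face at a time -/

/-- The size of a box in dimension `d` with `c` sides of length `q + 1` and `d - c` of length
`q`. -/
def boxSize (d q c : ℕ) : ℕ := q ^ (d - c) * (q + 1) ^ c

/-- The size of the `p`-th box in dimension `d + 1` when the sides of the unit box are increased
by one cyclically. -/
def cyclicBox (d p : ℕ) : ℕ := boxSize (d + 1) (p / (d + 1) + 1) (p % (d + 1))

/-- The size of the face added to the `p`-th box to obtain the next one. -/
def cyclicFace (d p : ℕ) : ℕ := boxSize d (p / (d + 1) + 1) (p % (d + 1))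

theorem boxSize_pos {d q c : ℕ} (hq : 1 ≤ q) : 1 ≤ boxSize d q c :=
  Nat.mul_pos (pow_pos hq _) (pow_pos (by omega) _)

theorem boxSize_eq_mul {d q c : ℕ} (hc : c ≤ d) : boxSize (d + 1) q c = q * boxSize d q c := by
  unfold boxSize
  rw [show d + 1 - c = (d - c) + 1 by omega]
  ring

theorem boxSize_succ_eq_mul (d q c : ℕ) :
    boxSize (d + 1) q (c + 1) = (q + 1) * boxSize d q c := by
  unfold boxSize
  rw [show d + 1 - (c + 1) = d - c by omega]
  ring

theorem boxSize_succ {d q c : ℕ} (hc : c ≤ d) :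
    boxSize (d + 1) q (c + 1) = boxSize (d + 1) q c + boxSize d q c := by
  rw [boxSize_succ_eq_mul, boxSize_eq_mul hc]
  ring

theorem boxSize_zero (d q : ℕ) : boxSize d q 0 = q ^ d := by simp [boxSize]

theorem boxSize_self (d q : ℕ) : boxSize d q d = (q + 1) ^ d := by simp [boxSize]

theorem boxSize_le_succ_pow {d q c : ℕ} (hc : c ≤ d) : boxSize d q c ≤ (q + 1) ^ d := by
  unfold boxSize
  calc q ^ (d - c) * (q + 1) ^ c ≤ (q + 1) ^ (d - c) * (q + 1) ^ c := by gcongr; omega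
    _ = (q + 1) ^ d := by rw [← pow_add, Nat.sub_add_cancel hc]

theorem pow_le_boxSize {d q c : ℕ} (hc : c ≤ d) : q ^ d ≤ boxSize d q c := by
  unfold boxSize
  calc q ^ d = q ^ (d - c) * q ^ c := by rw [← pow_add, Nat.sub_add_cancel hc]
    _ ≤ q ^ (d - c) * (q + 1) ^ c := by gcongr; omega

/-- The case `c = d + 1` is included: the end of one round is the cube that starts the next. -/
theorem cyclicBox_eq {d q c : ℕ} (hc : c ≤ d + 1) :
    cyclicBox d (q * (d + 1) + c) = boxSize (d + 1) (q + 1) c := by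
  unfold cyclicBox
  rcases Nat.lt_or_ge c (d + 1) with h | h
  · rw [Nat.mul_comm, Nat.mul_add_div (by omega), Nat.mul_add_mod, Nat.div_eq_of_lt h,
      Nat.mod_eq_of_lt h, Nat.add_zero]
  · obtain rfl : c = d + 1 := by omega
    rw [show q * (d + 1) + (d + 1) = (d + 1) * (q + 1) by ring, Nat.mul_div_cancel_left _ (by omega),
      Nat.mul_mod_right, boxSize_zero, boxSize_self]

theorem cyclicFace_eq {d q c : ℕ} (hc : c ≤ d) :
    cyclicFace d (q * (d + 1) + c) = boxSize d (q + 1) c := by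
  unfold cyclicFace
  rw [Nat.mul_comm, Nat.mul_add_div (by omega), Nat.mul_add_mod, Nat.div_eq_of_lt (by omega),
    Nat.mod_eq_of_lt (by omega), Nat.add_zero]

theorem exists_cyclic_index (d p : ℕ) : ∃ q c, c ≤ d ∧ p = q * (d + 1) + c :=
  ⟨p / (d + 1), p % (d + 1), Nat.le_of_lt_succ (Nat.mod_lt _ (by omega)),
    (Nat.div_add_mod' p (d + 1)).symm⟩

theorem cyclicBox_zero (d : ℕ) : cyclicBox d 0 = 1 := by simp [cyclicBox, boxSize]

theorem cyclicBox_succ (d p : ℕ) : cyclicBox d (p + 1) = cyclicBox d p + cyclicFace d p := by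
  obtain ⟨q, c, hc, rfl⟩ := exists_cyclic_index d p
  rw [add_assoc, cyclicBox_eq (by omega), cyclicBox_eq (by omega), cyclicFace_eq hc,
    boxSize_succ hc]

theorem cyclicFace_pos (d p : ℕ) : 1 ≤ cyclicFace d p := boxSize_pos (Nat.le_add_left 1 _)

theorem cyclicFace_mono (d : ℕ) : Monotone (cyclicFace d) := by
  refine monotone_nat_of_le_succ fun p => ?_
  obtain ⟨q, c, hc, rfl⟩ := exists_cyclic_index d p
  rcases Nat.lt_or_ge c d with h | h
  · obtain ⟨e, rfl⟩ : ∃ e, d = e + 1 := ⟨d - 1, by omega⟩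
    rw [add_assoc (q * _), cyclicFace_eq hc, cyclicFace_eq (by omega), boxSize_succ (by omega)]
    omega
  · obtain rfl : c = d := by omega
    rw [show q * (c + 1) + c + 1 = (q + 1) * (c + 1) + 0 by ring, cyclicFace_eq le_rfl,
      cyclicFace_eq (by omega), boxSize_self, boxSize_zero]

theorem cyclicBox_strictMono (d : ℕ) : StrictMono (cyclicBox d) :=
  strictMono_nat_of_lt_succ fun p => by
    rw [cyclicBox_succ]
    have := cyclicFace_pos d p
    omega

theorem lt_cyclicBox (d p : ℕ) : p < cyclicBox d p := by
  induction p with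
  | zero => simp [cyclicBox_zero]
  | succ p ih =>
    rw [cyclicBox_succ]
    have := cyclicFace_pos d p
    omega

/-- Every `m ≥ 2` lies in the block `(cyclicBox d p, cyclicBox d (p + 1)]` for some `p`. -/
theorem exists_eq_cyclicBox_add (d : ℕ) {m : ℕ} (hm : 2 ≤ m) :
    ∃ p s, 1 ≤ s ∧ s ≤ cyclicFace d p ∧ m = cyclicBox d p + s := by
  have hex : ∃ p, m ≤ cyclicBox d p := ⟨m, (lt_cyclicBox d m).le⟩
  obtain ⟨p, hp⟩ : ∃ p, Nat.find hex = p + 1 := by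
    refine Nat.exists_eq_succ_of_ne_zero fun h => ?_
    have := Nat.find_spec hex
    rw [h, cyclicBox_zero] at this
    omega
  have h1 := Nat.find_spec hex
  have h2 := Nat.find_min hex (m := p) (by omega)
  rw [hp, cyclicBox_succ] at h1
  exact ⟨p, m - cyclicBox d p, by omega, by omega, by omega⟩

/-! ### The excess function -/

/-- `maxExcess d m` is an upper bound for `|T| - ∑ i, |π_i T|` over the sets `T` of `m` points in
dimension `d`, where `π_i` forgets the `i`-th coordinate. It is the value for a set that fills the
boxes `cyclicBox` one after the other, each new face being filled in the same way. -/
def maxExcess : ℕ → ℕ → ℤ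
  | 0, m => m
  | d + 1, m =>
    if m = 0 then 0 else
      -d + ∑ j ∈ Finset.range (Nat.findGreatest (fun p => cyclicBox d p ≤ m) m),
          maxExcess d (cyclicFace d j) +
        maxExcess d (m - cyclicBox d (Nat.findGreatest (fun p => cyclicBox d p ≤ m) m))

theorem maxExcess_at_zero (d : ℕ) : maxExcess d 0 = 0 := by
  cases d <;> simp [maxExcess]

theorem maxExcess_cyclicBox_add_of_lt {d p s : ℕ} (hs : s < cyclicFace d p) :
    maxExcess (d + 1) (cyclicBox d p + s) =
      -d + ∑ j ∈ Finset.range p, maxExcess d (cyclicFace d j) + maxExcess d s := by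
  have hp := lt_cyclicBox d p
  have hfind : Nat.findGreatest (fun r => cyclicBox d r ≤ cyclicBox d p + s)
      (cyclicBox d p + s) = p := by
    rw [Nat.findGreatest_eq_iff]
    refine ⟨by omega, fun _ => by omega, fun n hn _ h => ?_⟩
    have := (cyclicBox_strictMono d).monotone (show p + 1 ≤ n from hn)
    rw [cyclicBox_succ] at this
    omega
  rw [maxExcess, if_neg (by omega), hfind, Nat.add_sub_cancel_left]

theorem maxExcess_cyclicBox_eq_sum (d p : ℕ) :
    maxExcess (d + 1) (cyclicBox d p) =
      -d + ∑ j ∈ Finset.range p, maxExcess d (cyclicFace d j) := by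
  simpa [maxExcess_at_zero] using maxExcess_cyclicBox_add_of_lt (cyclicFace_pos d p)

/-- A full face may be read either as the end of its block or as the next box; both readings give
the same value. -/
theorem maxExcess_cyclicBox_add {d p s : ℕ} (hs : s ≤ cyclicFace d p) :
    maxExcess (d + 1) (cyclicBox d p + s) =
      maxExcess (d + 1) (cyclicBox d p) + maxExcess d s := by
  rcases hs.lt_or_eq with h | rfl
  · rw [maxExcess_cyclicBox_add_of_lt h, maxExcess_cyclicBox_eq_sum]
  · rw [← cyclicBox_succ, maxExcess_cyclicBox_eq_sum, maxExcess_cyclicBox_eq_sum,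
      Finset.sum_range_succ]
    ring

theorem maxExcess_at_one (d : ℕ) : maxExcess d 1 = 1 - d := by
  cases d with
  | zero => simp [maxExcess]
  | succ d =>
    have := maxExcess_cyclicBox_eq_sum d 0
    rw [cyclicBox_zero] at this
    rw [this]
    push_cast
    simp

/-! ### Superadditivity and top-heaviness, by joint induction on the dimension -/

/-- Superadditivity of `maxExcess d`. -/
def MaxExcessSuperadditive (d : ℕ) : Prop :=
  ∀ a r, maxExcess d a + maxExcess d r ≤ maxExcess d (a + r)

/-- Among the intervals of length `h` below a box, the topmost one has the largest increment. -/
def MaxExcessTopHeavy (d : ℕ) : Prop :=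
  ∀ q c, c ≤ d → ∀ t h, t + h ≤ boxSize d (q + 1) c →
    maxExcess d (t + h) + maxExcess d (boxSize d (q + 1) c - h) ≤
      maxExcess d (boxSize d (q + 1) c) + maxExcess d t

theorem MaxExcessTopHeavy.face {d : ℕ} (hQ : MaxExcessTopHeavy d) {p t h : ℕ}
    (hth : t + h ≤ cyclicFace d p) :
    maxExcess d (t + h) + maxExcess d (cyclicFace d p - h) ≤
      maxExcess d (cyclicFace d p) + maxExcess d t := by
  obtain ⟨q, c, hc, rfl⟩ := exists_cyclic_index d p
  rw [cyclicFace_eq hc] at hth ⊢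
  exact hQ q c hc t h hth

/-- An interval of length `h` not longer than the last face ending below the box. -/
theorem maxExcess_interval_le_face {d p : ℕ} (hS : MaxExcessSuperadditive d)
    (hQ : MaxExcessTopHeavy d) :
    ∀ t h, h ≤ cyclicFace d p → t + h ≤ cyclicBox d (p + 1) →
      maxExcess (d + 1) (t + h) + maxExcess d (cyclicFace d p - h) ≤
        maxExcess d (cyclicFace d p) + maxExcess (d + 1) t := by
  intro t h
  induction h using Nat.strong_induction_on with
  | _ h ih =>
  intro hh hth
  rcases Nat.eq_zero_or_pos h with rfl | hpos
  · simp [add_comm]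
  rcases Nat.lt_or_ge (t + h) 2 with hlt | hge
  · obtain ⟨rfl, rfl⟩ : t = 0 ∧ h = 1 := by omega
    have h1 := hS (cyclicFace d p - 1) 1
    rw [Nat.sub_add_cancel hh, maxExcess_at_one] at h1
    rw [zero_add, maxExcess_at_one, maxExcess_at_zero]
    push_cast
    linarith
  obtain ⟨r, s, hs1, hs, hr⟩ := exists_eq_cyclicBox_add d hge
  have hrp : r ≤ p := by
    by_contra hcon
    have := (cyclicBox_strictMono d).monotone (show p + 1 ≤ r by omega)
    omega
  have hface := cyclicFace_mono d hrp
  rw [hr, maxExcess_cyclicBox_add hs]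
  -- If the interval starts below block `r`, its part in the block is cut off and merged by
  -- superadditivity; otherwise it lies in one block, where top-heaviness one dimension lower
  -- applies.
  rcases Nat.lt_or_ge s h with hsh | hsh
  · have hbox : cyclicBox d r = t + (h - s) := by omega
    have h1 := ih (h - s) (by omega) (by omega) (by omega)
    rw [← hbox] at h1
    have h2 := hS (cyclicFace d p - h) s
    rw [show cyclicFace d p - h + s = cyclicFace d p - (h - s) by omega] at h2
    linarith
  · obtain ⟨u, rfl⟩ : ∃ u, s = u + h := ⟨s - h, by omega⟩
    obtain rfl : t = cyclicBox d r + u := by omega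
    rw [maxExcess_cyclicBox_add (by omega)]
    have := hQ.face (p := p) (t := u) (h := h) (by omega)
    linarith

/-- An interval longer than the last face is split: its upper part is compared with the whole last
face, its lower part with the top of the preceding box. -/
theorem MaxExcessTopHeavy.box_succ {d : ℕ} (hS : MaxExcessSuperadditive d)
    (hQ : MaxExcessTopHeavy d) (p : ℕ) :
    ∀ t h, t + h ≤ cyclicBox d p →
      maxExcess (d + 1) (t + h) + maxExcess (d + 1) (cyclicBox d p - h) ≤
        maxExcess (d + 1) (cyclicBox d p) + maxExcess (d + 1) t := by
  induction p with
  | zero =>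
    intro t h hth
    rw [cyclicBox_zero] at hth ⊢
    obtain ⟨rfl, rfl⟩ | ⟨rfl, rfl⟩ | ⟨rfl, rfl⟩ :
      (t = 0 ∧ h = 0) ∨ (t = 1 ∧ h = 0) ∨ (t = 0 ∧ h = 1) := by omega
    all_goals simp [add_comm]
  | succ p ih =>
    intro t h hth
    have hsucc := cyclicBox_succ d p
    rcases Nat.le_total h (cyclicFace d p) with hle | hle
    · have h1 := maxExcess_interval_le_face hS hQ t h hle hth
      rw [show cyclicBox d (p + 1) - h = cyclicBox d p + (cyclicFace d p - h) by omega,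
        maxExcess_cyclicBox_add (Nat.sub_le _ _), hsucc, maxExcess_cyclicBox_add le_rfl]
      linarith
    · obtain ⟨g, rfl⟩ : ∃ g, h = g + cyclicFace d p := ⟨h - cyclicFace d p, by omega⟩
      have h1 := maxExcess_interval_le_face hS hQ (t + g) (cyclicFace d p) le_rfl (by omega)
      have h2 := ih t g (by omega)
      rw [Nat.sub_self, maxExcess_at_zero] at h1
      rw [show cyclicBox d (p + 1) - (g + cyclicFace d p) = cyclicBox d p - g by omega, hsucc,
        maxExcess_cyclicBox_add le_rfl, ← add_assoc]
      linarith

theorem MaxExcessTopHeavy.succ {d : ℕ} (hS : MaxExcessSuperadditive d)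
    (hQ : MaxExcessTopHeavy d) : MaxExcessTopHeavy (d + 1) := by
  intro q c hc t h hth
  rw [← cyclicBox_eq hc] at hth ⊢
  exact MaxExcessTopHeavy.box_succ hS hQ _ t h hth

/-- Removing an interval that fits into the last block, or into the previous face. -/
theorem maxExcess_sub_add_le {d p s h : ℕ} (hS : MaxExcessSuperadditive d)
    (hQ : MaxExcessTopHeavy d) (hs : s ≤ cyclicFace d p)
    (hh : h ≤ s ∨ ∃ p', p = p' + 1 ∧ h ≤ cyclicFace d p') :
    maxExcess (d + 1) (cyclicBox d p + s - h) + maxExcess d h ≤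
      maxExcess (d + 1) (cyclicBox d p + s) := by
  rcases Nat.le_total h s with hle | hle
  · have := hS (s - h) h
    rw [Nat.sub_add_cancel hle] at this
    rw [Nat.add_sub_assoc hle, maxExcess_cyclicBox_add (by omega), maxExcess_cyclicBox_add hs]
    linarith
  · rcases hle.eq_or_lt with rfl | hlt
    · rw [Nat.add_sub_cancel, maxExcess_cyclicBox_add hs]
    -- The removal uses up all of `s` and eats `h - s` into the previous face.
    obtain ⟨p', rfl, hp'⟩ := hh.resolve_left (by omega)
    have h1 := hQ.face (p := p') (t := s) (h := h - s) (by omega)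
    rw [maxExcess_cyclicBox_add hs, cyclicBox_succ,
      show cyclicBox d p' + cyclicFace d p' + s - h
        = cyclicBox d p' + (cyclicFace d p' - (h - s)) by omega,
      maxExcess_cyclicBox_add (Nat.sub_le _ _), maxExcess_cyclicBox_add le_rfl]
    rw [show s + (h - s) = h by omega] at h1
    linarith

/-- The last partial block of `r` is small enough to be removed from `a + r` by
`maxExcess_sub_add_le`; what remains of `r` is a box, treated by induction. -/
theorem MaxExcessSuperadditive.succ {d : ℕ} (hS : MaxExcessSuperadditive d)
    (hQ : MaxExcessTopHeavy d) : MaxExcessSuperadditive (d + 1) := by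
  intro a r
  induction r using Nat.strong_induction_on with
  | _ r ih =>
  rcases Nat.eq_zero_or_pos a with rfl | ha
  · simp [maxExcess_at_zero]
  rcases Nat.eq_zero_or_pos r with rfl | hr
  · simp [maxExcess_at_zero]
  obtain ⟨p, s, hs1, hs, hm⟩ := exists_eq_cyclicBox_add d (show 2 ≤ a + r by omega)
  rcases Nat.lt_or_ge r 2 with hlt | hge
  · obtain rfl : r = 1 := by omega
    have h1 := maxExcess_sub_add_le hS hQ hs (h := 1) (Or.inl hs1)
    rw [← hm, Nat.add_sub_cancel, maxExcess_at_one] at h1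
    rw [maxExcess_at_one]
    push_cast
    linarith
  · obtain ⟨p₂, s₂, hs₂1, hs₂, rfl⟩ := exists_eq_cyclicBox_add d hge
    have hp : p₂ ≤ p := by
      by_contra hcon
      have := (cyclicBox_strictMono d).monotone (show p + 1 ≤ p₂ by omega)
      rw [cyclicBox_succ] at this
      omega
    have h1 := ih (cyclicBox d p₂) (by omega)
    have h2 := maxExcess_sub_add_le hS hQ hs (h := s₂) <| by
      rcases hp.eq_or_lt with rfl | hlt
      · exact Or.inl (by omega)
      · exact Or.inr ⟨p - 1, by omega, hs₂.trans (cyclicFace_mono d (by omega))⟩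
    rw [← hm, show a + (cyclicBox d p₂ + s₂) - s₂ = a + cyclicBox d p₂ by omega] at h2
    rw [maxExcess_cyclicBox_add hs₂]
    linarith

theorem maxExcess_superadditive_and_topHeavy (d : ℕ) :
    MaxExcessSuperadditive d ∧ MaxExcessTopHeavy d := by
  induction d with
  | zero =>
    refine ⟨fun a r => by simp [maxExcess], fun q c hc t h hth => ?_⟩
    simp only [maxExcess]
    push_cast [show h ≤ boxSize 0 (q + 1) c by omega]
    linarith
  | succ d ih => exact ⟨ih.1.succ ih.2, ih.2.succ ih.1⟩

/-! ### The slice inequality -/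

/-- The numerical form of deleting the smallest of `k` slices. -/
theorem maxExcess_slice_le (d : ℕ) : ∀ m h k, 2 ≤ k → m ≤ k ^ (d + 1) → k * h ≤ m →
    maxExcess (d + 1) (m - h) + maxExcess d h ≤ maxExcess (d + 1) m := by
  induction d with
  | zero =>
    intro m h k hk hm hkh
    obtain ⟨hS, hQ⟩ := maxExcess_superadditive_and_topHeavy 0
    rcases Nat.eq_zero_or_pos h with rfl | hpos
    · simp [maxExcess_at_zero]
    obtain ⟨p, s, hs1, hs, rfl⟩ := exists_eq_cyclicBox_add 0 (show 2 ≤ m by nlinarith)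
    refine maxExcess_sub_add_le hS hQ hs (Or.inl ?_)
    by_contra hcon
    have : 2 ≤ h := by omega
    rw [zero_add, pow_one] at hm
    nlinarith
  | succ d ih =>
    intro m h k hk hm hkh
    obtain ⟨hS, hQ⟩ := maxExcess_superadditive_and_topHeavy (d + 1)
    rcases Nat.eq_zero_or_pos h with rfl | hpos
    · simp [maxExcess_at_zero]
    obtain ⟨p, s, hs1, hs, rfl⟩ := exists_eq_cyclicBox_add (d + 1) (show 2 ≤ m by nlinarith)
    obtain ⟨q, c, hc, rfl⟩ := exists_cyclic_index (d + 1) p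
    -- `m` exceeds the cube of side `q + 1`, so the containing cube has side at least `q + 2`.
    have hqk : q + 2 ≤ k := by
      by_contra hcon
      have h1 : k ^ (d + 1 + 1) ≤ (q + 1) ^ (d + 1 + 1) := Nat.pow_le_pow_left (by omega) _
      have h2 := pow_le_boxSize (q := q + 1) (show c ≤ d + 1 + 1 by omega)
      rw [cyclicBox_eq (by omega)] at hm
      omega
    have hh : (q + 2) * h ≤ cyclicBox (d + 1) (q * (d + 1 + 1) + c) + s :=
      (Nat.mul_le_mul_right _ hqk).trans hkh
    rcases Nat.eq_zero_or_pos c with rfl | hcpos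
    · have hle : h ≤ cyclicFace (d + 1) (q * (d + 1 + 1) + 0) := by
        rw [cyclicBox_eq (by omega), boxSize_eq_mul (by omega)] at hh
        rw [cyclicFace_eq (by omega)] at hs ⊢
        by_contra hcon
        nlinarith
      refine maxExcess_sub_add_le hS hQ hs ?_
      rcases Nat.eq_zero_or_pos q with rfl | hq
      · left
        rw [cyclicFace_eq (by omega), boxSize_zero] at hle
        simp at hle
        omega
      · right
        obtain ⟨q, rfl⟩ : ∃ q', q = q' + 1 := ⟨q - 1, by omega⟩
        refine ⟨q * (d + 1 + 1) + (d + 1), by ring, ?_⟩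
        rw [cyclicFace_eq (by omega), boxSize_zero] at hle
        rwa [cyclicFace_eq (by omega), boxSize_self]
    · obtain ⟨c, rfl⟩ : ∃ c', c = c' + 1 := ⟨c - 1, by omega⟩
      by_cases hprev : h ≤ s ∨ h ≤ cyclicFace (d + 1) (q * (d + 1 + 1) + c)
      · exact maxExcess_sub_add_le hS hQ hs (hprev.imp_right fun h => ⟨_, by ring, h⟩)
      -- The box is `q + 2` copies of the previous face, so the overhang `t` of `h` beyond that face
      -- satisfies `(q + 2) * t ≤ s`: the same problem one dimension lower, for the last block.
      push Not at hprev
      obtain ⟨hsh, hph⟩ := hprev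
      rw [cyclicFace_eq (by omega)] at hs hph
      have hβ : cyclicBox (d + 1) (q * (d + 1 + 1) + (c + 1))
          = (q + 1 + 1) * boxSize (d + 1) (q + 1) c := by
        rw [cyclicBox_eq (by omega), boxSize_succ_eq_mul]
      obtain ⟨t, rfl⟩ : ∃ t, h = boxSize (d + 1) (q + 1) c + t := ⟨_,
        (Nat.add_sub_of_le hph.le).symm⟩
      have ht : (q + 2) * t ≤ s := by
        rw [hβ] at hh
        nlinarith
      have htd : t ≤ boxSize d (q + 1) c := by
        rw [boxSize_succ_eq_mul] at hs
        exact Nat.le_of_mul_le_mul_left (ht.trans hs) (by omega)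
      have h1 := ih s t (q + 2) (by omega)
        (hs.trans (boxSize_le_succ_pow (by omega))) ht
      have h2 : maxExcess (d + 1) (boxSize (d + 1) (q + 1) c + t) =
          maxExcess (d + 1) (boxSize (d + 1) (q + 1) c) + maxExcess d t := by
        rw [← cyclicBox_eq (by omega)]
        exact maxExcess_cyclicBox_add (by rwa [cyclicFace_eq (by omega)])
      have hts : t ≤ s := by nlinarith
      have hfs : cyclicFace (d + 1) (q * (d + 1 + 1) + c) = boxSize (d + 1) (q + 1) c :=
        cyclicFace_eq (by omega)
      rw [maxExcess_cyclicBox_add (by rwa [cyclicFace_eq (by omega)]), h2, ← add_assoc (q * _),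
        cyclicBox_succ, hfs,
        show cyclicBox (d + 1) (q * (d + 1 + 1) + c) + boxSize (d + 1) (q + 1) c + s
          - (boxSize (d + 1) (q + 1) c + t)
          = cyclicBox (d + 1) (q * (d + 1 + 1) + c) + (s - t) by omega,
        maxExcess_cyclicBox_add (by omega), ← hfs, maxExcess_cyclicBox_add le_rfl]
      linarith

/-! ### The sign of the excess -/

/-- The excess of a product of a box with an interval. -/
theorem maxExcess_boxSize (d : ℕ) : ∀ q c, c ≤ d →
    maxExcess (d + 1) (boxSize (d + 1) (q + 1) c) =
      (q + 1) * maxExcess d (boxSize d (q + 1) c) - boxSize d (q + 1) c := by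
  have step : ∀ d q c, c ≤ d → maxExcess (d + 1) (boxSize (d + 1) (q + 1) (c + 1)) =
      maxExcess (d + 1) (boxSize (d + 1) (q + 1) c) + maxExcess d (boxSize d (q + 1) c) := by
    intro d q c hc
    rw [← cyclicBox_eq (by omega), ← add_assoc, cyclicBox_succ, maxExcess_cyclicBox_add le_rfl,
      cyclicBox_eq (by omega), cyclicFace_eq (by omega)]
  induction d with
  | zero =>
    intro q c hc
    obtain rfl : c = 0 := by omega
    induction q with
    | zero => simp [boxSize, maxExcess_at_one]
    | succ q ihq =>
      have := step 0 q 0 le_rfl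
      rw [ihq] at this
      simp only [boxSize, maxExcess] at this ⊢
      simp at this ⊢
      linarith
  | succ d ih =>
    have grow : ∀ q, maxExcess (d + 2) (boxSize (d + 2) (q + 1) 0) =
        (q + 1) * maxExcess (d + 1) (boxSize (d + 1) (q + 1) 0) - boxSize (d + 1) (q + 1) 0 →
        ∀ c, c ≤ d + 1 → maxExcess (d + 2) (boxSize (d + 2) (q + 1) c) =
        (q + 1) * maxExcess (d + 1) (boxSize (d + 1) (q + 1) c) - boxSize (d + 1) (q + 1) c := by
      intro q h0 c
      induction c with
      | zero => exact fun _ => h0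
      | succ c ihc =>
        intro hc
        rw [step (d + 1) q c (by omega), step d q c (by omega), ihc (by omega),
          boxSize_succ (show c ≤ d by omega), ih q c (by omega)]
        push_cast
        ring
    intro q
    refine grow q ?_
    induction q with
    | zero =>
      simp only [boxSize_zero, zero_add, one_pow, maxExcess_at_one]
      push_cast
      ring
    | succ q ihq =>
      have h1 := step (d + 1) q (d + 1) le_rfl
      rw [grow q ihq (d + 1) le_rfl, boxSize_self, boxSize_self] at h1
      rw [boxSize_zero, boxSize_zero, h1]
      push_cast
      ring

/-- Lines in a cube of side `q` have at most `q` points. -/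
theorem mul_maxExcess_le (d : ℕ) : ∀ q m : ℕ, m ≤ q ^ d →
    (q : ℤ) * maxExcess d m ≤ (q - d) * m := by
  induction d with
  | zero => intro q m _; simp [maxExcess]
  | succ d ih =>
    intro q m hm
    rcases Nat.lt_or_ge m 2 with hlt | hge
    · rcases (show m = 0 ∨ m = 1 by omega) with rfl | rfl
      · simp [maxExcess_at_zero]
      · have : 1 ≤ q := by
          by_contra hq
          obtain rfl : q = 0 := by omega
          simp at hm
        rw [maxExcess_at_one]
        push_cast
        nlinarith
    obtain ⟨p, s, hs1, hs, rfl⟩ := exists_eq_cyclicBox_add d hge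
    obtain ⟨r, c, hc, rfl⟩ := exists_cyclic_index d p
    rw [maxExcess_cyclicBox_add hs, cyclicBox_eq (by omega), maxExcess_boxSize d r c hc,
      boxSize_eq_mul hc]
    rw [cyclicBox_eq (by omega)] at hm
    rw [cyclicFace_eq hc] at hs
    have hrq : r + 2 ≤ q := by
      by_contra hcon
      have h1 : q ^ (d + 1) ≤ (r + 1) ^ (d + 1) := Nat.pow_le_pow_left (by omega) _
      have h2 := pow_le_boxSize (q := r + 1) (show c ≤ d + 1 by omega)
      omega
    have hbq : boxSize d (r + 1) c ≤ q ^ d :=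
      (boxSize_le_succ_pow hc).trans (Nat.pow_le_pow_left (by omega) _)
    have h1 := ih q _ hbq
    have h2 := ih q s (hs.trans hbq)
    generalize boxSize d (r + 1) c = b at *
    generalize maxExcess d b = x at *
    generalize maxExcess d s = y at *
    have hs' : (s : ℤ) ≤ b := by exact_mod_cast hs
    have hrq' : (r : ℤ) + 2 ≤ q := by exact_mod_cast hrq
    have h3 : ((r : ℤ) + 1) * (q * x) ≤ (r + 1) * ((q - d) * b) :=
      mul_le_mul_of_nonneg_left h1 (by positivity)
    have h4 : (b : ℤ) * (r + 2) ≤ b * q := mul_le_mul_of_nonneg_left hrq' (by positivity)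
    push_cast
    linarith

theorem sum_pow_self_le (d : ℕ) : ∑ i ∈ Finset.Icc 1 d, i ^ i ≤ (d + 1) ^ d := by
  induction d with
  | zero => simp
  | succ d ih =>
    rw [Finset.sum_Icc_succ_top (by omega)]
    have h : (d + 1) ^ (d + 1) ≤ (d + 1) * (d + 2) ^ d := by
      rw [pow_succ, mul_comm]
      gcongr
      omega
    have h' : (d + 1) ^ d ≤ (d + 2) ^ d := by gcongr; omega
    calc _ ≤ (d + 2) ^ d + (d + 1) * (d + 2) ^ d := by omega
      _ = (d + 1 + 1) ^ (d + 1) := by ring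

/-- When the side equals the dimension, the factor in `mul_maxExcess_le` vanishes, which settles
sizes up to that cube. Beyond it only the excess of the remainder, one dimension lower, is added;
`sum_pow_self_le` keeps the remainder within one face. -/
theorem maxExcess_nonpos {d m : ℕ} (hm : m ≤ ∑ i ∈ Finset.Icc 1 d, i ^ i) :
    maxExcess d m ≤ 0 := by
  induction d generalizing m with
  | zero =>
    obtain rfl : m = 0 := by simpa using hm
    simp [maxExcess]
  | succ d ih =>
    have hcube : ∀ r ≤ (d + 1) ^ (d + 1), maxExcess (d + 1) r ≤ 0 := by
      intro r hr
      have := mul_maxExcess_le (d + 1) (d + 1) r hr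
      rw [sub_self, zero_mul] at this
      exact nonpos_of_mul_nonpos_right this (by positivity)
    rcases Nat.le_total m ((d + 1) ^ (d + 1)) with h | h
    · exact hcube m h
    · obtain ⟨s, rfl⟩ := Nat.exists_eq_add_of_le h
      rw [Finset.sum_Icc_succ_top (by omega)] at hm
      have hs : s ≤ ∑ i ∈ Finset.Icc 1 d, i ^ i := by omega
      have h1 := hcube _ le_rfl
      have hbox := cyclicBox_eq (d := d) (q := d) (c := 0) (by omega)
      have hface := cyclicFace_eq (d := d) (q := d) (c := 0) (by omega)
      rw [boxSize_zero] at hbox hface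
      rw [← hbox] at h1 ⊢
      rw [maxExcess_cyclicBox_add (by rw [hface]; exact hs.trans (sum_pow_self_le d))]
      linarith [ih hs]

/-! ### Projections of finite sets -/

/-- If the points of `T` agree outside `J`, then `T` is at most as large as the box spanned by its
coordinates in `J`. -/
theorem card_le_prod_card_image {ι α : Type*} [DecidableEq ι] [DecidableEq α]
    {J : Finset ι} {T : Finset (ι → α)}
    (hT : ∀ x ∈ T, ∀ y ∈ T, ∀ i ∉ J, x i = y i) :
    T.card ≤ ∏ i ∈ J, (T.image fun x => x i).card := by
  rw [← Finset.prod_coe_sort J fun i => (T.image fun x => x i).card, ← Fintype.card_piFinset]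
  refine Finset.card_le_card_of_injOn (fun x (j : J) => x j) ?_ ?_
  · intro x hx
    simp only [Fintype.coe_piFinset, Set.mem_univ_pi]
    exact fun j => Finset.mem_coe.2 (Finset.mem_image_of_mem (fun x : ι → α => x j) hx)
  · intro x hx y hy hxy
    funext i
    by_cases hi : i ∈ J
    · exact congrFun hxy ⟨i, hi⟩
    · exact hT x hx y hy i hi

/-- The projection of `T` that forgets the coordinate `i`. -/
def coordProj {ι α : Type*} [DecidableEq ι] [DecidableEq α] [Fintype ι] (i : ι)
    (T : Finset (ι → α)) : Finset ({j // j ≠ i} → α) :=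
  T.image fun x j => x j

section Projections

variable {ι α : Type*} [DecidableEq ι] [DecidableEq α] [Fintype ι]

theorem coordProj_mono (i : ι) {S T : Finset (ι → α)} (h : S ⊆ T) :
    coordProj i S ⊆ coordProj i T :=
  Finset.image_subset_image h

theorem coordProj_union (i : ι) (S T : Finset (ι → α)) :
    coordProj i (S ∪ T) = coordProj i S ∪ coordProj i T :=
  Finset.image_union _ _

/-- Forgetting `j` keeps coordinate `i`, so the slice and its complement have disjoint projections.
-/
theorem card_coordProj_slice {i j : ι} (hij : i ≠ j) (a : α) (T : Finset (ι → α)) :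
    (coordProj j T).card =
      (coordProj j {x ∈ T | ¬ x i = a}).card + (coordProj j {x ∈ T | x i = a}).card := by
  rw [← Finset.card_union_of_disjoint, ← coordProj_union, Finset.union_comm,
    Finset.filter_union_filter_not_eq]
  simp only [coordProj, Finset.disjoint_left, Finset.mem_image, Finset.mem_filter]
  rintro _ ⟨x, ⟨_, hx⟩, rfl⟩ ⟨y, ⟨_, hy⟩, hxy⟩
  exact hx ((congrFun hxy ⟨i, hij⟩).symm.trans hy)

/-- The excess of `T` over its projections in the directions `J` is bounded by `maxExcess`. -/
theorem card_sub_sum_card_coordProj_le (T : Finset (ι → α)) :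
    ∀ J : Finset ι, (∀ x ∈ T, ∀ y ∈ T, ∀ i ∉ J, x i = y i) →
      (T.card : ℤ) - ∑ i ∈ J, ((coordProj i T).card : ℤ) ≤ maxExcess J.card T.card := by
  induction T using Finset.strongInduction with
  | H T ih =>
  intro J hJ
  rcases T.eq_empty_or_nonempty with rfl | hne
  · simp [maxExcess_at_zero, coordProj]
  rcases J.eq_empty_or_nonempty with rfl | hJne
  · simp [maxExcess]
  obtain ⟨i, hi, hmax⟩ := J.exists_max_image (fun i => (T.image fun x => x i).card) hJne
  set k := (T.image fun x => x i).card with hk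
  have hbox : T.card ≤ k ^ J.card :=
    (card_le_prod_card_image hJ).trans (Finset.prod_le_pow_card _ _ _ hmax)
  obtain ⟨d, hd⟩ : ∃ d, J.card = d + 1 := ⟨J.card - 1, by have := hJne.card_pos; omega⟩
  have hkpos : 1 ≤ k := (hne.image _).card_pos
  rcases hkpos.eq_or_lt with hk1 | hk2
  · have hcard : T.card = 1 := by
      have := hne.card_pos
      rw [← hk1, one_pow] at hbox
      omega
    obtain ⟨x, rfl⟩ := Finset.card_eq_one.1 hcard
    simp [coordProj, maxExcess_at_one]
  obtain ⟨a, ha, hmin⟩ := (T.image fun x : ι → α => x i).exists_min_image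
    (fun a => (T.filter fun x : ι → α => x i = a).card) (hne.image _)
  set A := T.filter (fun x => x i = a) with hA
  set B := T.filter (fun x => ¬ x i = a)
  have hAB : B.card + A.card = T.card := by
    rw [add_comm]
    exact Finset.card_filter_add_card_filter_not _
  have hkA : k * A.card ≤ T.card := by
    rw [Finset.card_eq_sum_card_image (fun x => x i) T, hk, ← smul_eq_mul]
    exact Finset.card_nsmul_le_sum _ _ _ hmin
  have hApos : 0 < A.card := by
    obtain ⟨x, hx, hxa⟩ := Finset.mem_image.1 ha
    exact Finset.card_pos.2 ⟨x, Finset.mem_filter.2 ⟨hx, hxa⟩⟩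
  have hAT : A ⊂ T := by
    refine (Finset.filter_subset _ _).ssubset_of_ne fun h => ?_
    have : A.card = T.card := congrArg Finset.card h
    nlinarith
  have hBT : B ⊂ T := by
    refine (Finset.filter_subset _ _).ssubset_of_ne fun h => ?_
    have : B.card = T.card := congrArg Finset.card h
    omega
  have h1 := ih A hAT (J.erase i) <| by
    intro x hx y hy j hj
    rw [hA, Finset.mem_filter] at hx hy
    by_cases hji : j = i
    · rw [hji, hx.2, hy.2]
    · exact hJ x hx.1 y hy.1 j fun h => hj (Finset.mem_erase.2 ⟨hji, h⟩)
  have h2 := ih B hBT J fun x hx y hy => hJ x (hBT.1 hx) y (hBT.1 hy)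
  rw [hd] at hbox h2 ⊢
  rw [Finset.card_erase_of_mem hi, hd, Nat.add_sub_cancel] at h1
  have h3 := maxExcess_slice_le d T.card A.card k hk2 hbox hkA
  rw [← hAB, Nat.add_sub_cancel] at h3
  rw [← Finset.add_sum_erase J _ hi] at h2 ⊢
  have hi' : ((coordProj i B).card : ℤ) ≤ (coordProj i T).card := by
    exact_mod_cast Finset.card_le_card (coordProj_mono i hBT.1)
  have hsum : ∑ j ∈ J.erase i, ((coordProj j T).card : ℤ) =
      ∑ j ∈ J.erase i, ((coordProj j B).card : ℤ) +
        ∑ j ∈ J.erase i, ((coordProj j A).card : ℤ) := by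
    rw [← Finset.sum_add_distrib]
    refine Finset.sum_congr rfl fun j hj => ?_
    rw [card_coordProj_slice (Finset.ne_of_mem_erase hj).symm a T]
    push_cast
    rfl
  rw [hsum, ← hAB]
  push_cast
  linarith

theorem card_le_sum_card_coordProj {T : Finset (ι → α)}
    (hT : T.card ≤ ∑ i ∈ Finset.Icc 1 (Fintype.card ι), i ^ i) :
    T.card ≤ ∑ i, (coordProj i T).card := by
  have h1 := card_sub_sum_card_coordProj_le T Finset.univ fun _ _ _ _ i hi =>
    absurd (Finset.mem_univ i) hi
  have h2 := maxExcess_nonpos hT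
  rw [Finset.card_univ] at h1
  zify
  linarith

/-! ### Covering by guesses -/

/-- A small set of points can be covered by guessing each point along one of the coordinate
directions, knowing all its other coordinates. -/
theorem exists_guess_of_card_le {T : Finset (ι → α)} [Nonempty α]
    (hT : T.card ≤ ∑ i ∈ Finset.Icc 1 (Fintype.card ι), i ^ i) :
    ∃ g : (i : ι) → ({j // j ≠ i} → α) → α, ∀ x ∈ T, ∃ i, g i (fun j => x j) = x i := by
  classical
  obtain ⟨φ, hinj, hφ⟩ := (Finset.all_card_le_biUnion_card_iff_exists_injective
    (fun x : T => Finset.univ.image fun i : ι =>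
      (⟨i, fun j => x.1 j⟩ : Σ i : ι, {j // j ≠ i} → α))).1 <| by
    intro S
    have hS : (S.map (Function.Embedding.subtype _)).card = S.card := Finset.card_map _
    have hsub : (S.map (Function.Embedding.subtype _)).card ≤ T.card := by
      refine Finset.card_le_card fun x hx => ?_
      obtain ⟨y, _, rfl⟩ := Finset.mem_map.1 hx
      exact y.2
    have := card_le_sum_card_coordProj (hsub.trans hT)
    rw [hS, ← Finset.card_sigma] at this
    refine this.trans (Finset.card_le_card ?_)
    rintro ⟨i, z⟩ hz
    obtain ⟨x, hx, hxz⟩ := Finset.mem_image.1 (Finset.mem_sigma.1 hz).2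
    obtain ⟨y, hy, rfl⟩ := Finset.mem_map.1 hx
    exact Finset.mem_biUnion.2 ⟨y, hy, Finset.mem_image.2
      ⟨i, Finset.mem_univ _, Sigma.ext rfl (heq_of_eq hxz)⟩⟩
  -- Player `i` guesses the point matched to the line it sees, unique by injectivity; unmatched
  -- lines get a dummy guess.
  refine ⟨fun i z => if h : ∃ x : T, φ x = ⟨i, z⟩ then h.choose.1 i else Classical.arbitrary α,
    fun x hx => ?_⟩
  obtain ⟨i, _, hi⟩ := Finset.mem_image.1 (hφ ⟨x, hx⟩)
  have hex : ∃ y : T, φ y = ⟨i, fun j => x j⟩ := ⟨⟨x, hx⟩, hi.symm⟩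
  refine ⟨i, ?_⟩
  dsimp only
  rw [dif_pos hex, hinj (hex.choose_spec.trans hi)]

/-- If `T` has more points than projections altogether, every guessing scheme misses a point. -/
theorem exists_forall_guess_ne {T : Finset (ι → α)} (hT : ∑ i, (coordProj i T).card < T.card)
    (g : (i : ι) → ({j // j ≠ i} → α) → α) : ∃ x ∈ T, ∀ i, g i (fun j => x j) ≠ x i := by
  by_contra! hcon
  have hcover : T ⊆ Finset.univ.biUnion fun i => {x ∈ T | g i (fun j => x j) = x i} := by
    intro x hx
    obtain ⟨i, hi⟩ := hcon x hx
    exact Finset.mem_biUnion.2 ⟨i, Finset.mem_univ i, Finset.mem_filter.2 ⟨hx, hi⟩⟩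
  refine absurd ((Finset.card_le_card hcover).trans Finset.card_biUnion_le) (not_le.2 ?_)
  refine lt_of_le_of_lt (Finset.sum_le_sum fun i _ => ?_) hT
  refine Finset.card_le_card_of_injOn (fun x j => x j) ?_ ?_
  · exact fun x hx => Finset.mem_coe.2 (Finset.mem_image_of_mem _ (Finset.mem_filter.1 hx).1)
  · intro x hx y hy hxy
    funext j
    by_cases hj : j = i
    · subst hj
      rw [← (Finset.mem_filter.1 hx).2, ← (Finset.mem_filter.1 hy).2]
      exact congrArg (g j) hxy
    · exact congrFun hxy ⟨j, hj⟩

end Projections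

/-! ### The extremal set -/

theorem coordProj_piFinset_card_le {d k : ℕ} (i : Fin (d + 1)) :
    (coordProj i (Fintype.piFinset fun _ : Fin (d + 1) => Finset.range k)).card ≤ k ^ d := by
  calc _ ≤ (Fintype.piFinset fun _ : {j // j ≠ i} => Finset.range k).card := by
        refine Finset.card_le_card fun z hz => ?_
        obtain ⟨x, hx, rfl⟩ := Finset.mem_image.1 hz
        exact Fintype.mem_piFinset.2 fun j => Fintype.mem_piFinset.1 hx j
    _ = k ^ d := by simp [Fintype.card_subtype_compl]

/-- A cube together with a copy of the lower-dimensional extremal set in an adjacent hyperplane. -/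
theorem exists_sum_card_coordProj_lt (d : ℕ) : ∃ T : Finset (Fin d → ℕ),
    (∀ x ∈ T, ∀ i, x i ≤ d) ∧ T.card = 1 + ∑ i ∈ Finset.Icc 1 d, i ^ i ∧
      ∑ i, (coordProj i T).card < T.card := by
  induction d with
  | zero => exact ⟨{Fin.elim0}, by simp, by simp, by simp⟩
  | succ d ih =>
    obtain ⟨T, hle, hcard, hlt⟩ := ih
    set C : Finset (Fin (d + 1) → ℕ) := Fintype.piFinset fun _ => Finset.range (d + 1) with hC
    set U : Finset (Fin (d + 1) → ℕ) := T.image (Fin.cons (d + 1)) with hU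
    have hCcard : C.card = (d + 1) ^ (d + 1) := by simp [hC]
    have hUcard : U.card = T.card :=
      Finset.card_image_of_injective _ (Fin.cons_right_injective (α := fun _ => ℕ) (d + 1))
    have hdisj : Disjoint C U := by
      rw [Finset.disjoint_left]
      intro x hx hxU
      obtain ⟨y, _, rfl⟩ := Finset.mem_image.1 hxU
      have := Fintype.mem_piFinset.1 hx 0
      simp at this
    -- The bound `x i ≤ d` puts the shadow of `U` inside that of the cube, so `U` costs nothing in
    -- direction `0`. The cube has excess zero, so the excess of `T` survives.
    have hzero : (coordProj 0 (C ∪ U)).card ≤ (d + 1) ^ d := by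
      refine le_trans (Finset.card_le_card ?_) (coordProj_piFinset_card_le (k := d + 1) 0)
      rw [coordProj_union]
      refine Finset.union_subset le_rfl fun z hz => ?_
      obtain ⟨x, hx, rfl⟩ := Finset.mem_image.1 hz
      obtain ⟨y, hy, rfl⟩ := Finset.mem_image.1 hx
      refine Finset.mem_image.2 ⟨Fin.cons 0 y, Fintype.mem_piFinset.2 fun j => ?_, ?_⟩
      · refine Fin.cases (by simp) (fun j => ?_) j
        simpa using Nat.lt_succ_of_le (hle y hy j)
      · funext ⟨j, hj⟩
        obtain ⟨j, rfl⟩ := Fin.exists_succ_eq.2 hj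
        simp
    have hsucc : ∀ i : Fin d, (coordProj i.succ (C ∪ U)).card ≤
        (d + 1) ^ d + (coordProj i T).card := by
      intro i
      rw [coordProj_union]
      refine (Finset.card_union_le _ _).trans (Nat.add_le_add (coordProj_piFinset_card_le _) ?_)
      refine Finset.card_le_card_of_injOn
        (fun z j => z ⟨j.1.succ, fun h => j.2 (Fin.succ_injective _ h)⟩) ?_ ?_
      · intro z hz
        obtain ⟨x, hx, rfl⟩ := Finset.mem_image.1 (Finset.mem_coe.1 hz)
        obtain ⟨y, hy, rfl⟩ := Finset.mem_image.1 hx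
        exact Finset.mem_coe.2 (Finset.mem_image.2 ⟨y, hy, by funext j; simp⟩)
      · intro z hz w hw hzw
        obtain ⟨x, hx, rfl⟩ := Finset.mem_image.1 (Finset.mem_coe.1 hz)
        obtain ⟨y, hy, rfl⟩ := Finset.mem_image.1 hx
        obtain ⟨x', hx', rfl⟩ := Finset.mem_image.1 (Finset.mem_coe.1 hw)
        obtain ⟨y', hy', rfl⟩ := Finset.mem_image.1 hx'
        funext ⟨j, hj⟩
        induction j using Fin.cases with
        | zero => simp
        | succ j => exact congrFun hzw ⟨j, fun h => hj (congrArg _ h)⟩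
    have hunion : (C ∪ U).card = (d + 1) ^ (d + 1) + T.card := by
      rw [Finset.card_union_of_disjoint hdisj, hCcard, hUcard]
    refine ⟨C ∪ U, ?_, ?_, ?_⟩
    · intro x hx i
      rcases Finset.mem_union.1 hx with h | h
      · exact (Finset.mem_range.1 (Fintype.mem_piFinset.1 h i)).le
      · obtain ⟨y, hy, rfl⟩ := Finset.mem_image.1 h
        refine Fin.cases (by simp) (fun j => ?_) i
        simpa using (hle y hy j).trans (Nat.le_succ d)
    · rw [hunion, hcard, Finset.sum_Icc_succ_top (by omega)]
      ring
    · rw [hunion, Fin.sum_univ_succ]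
      have h1 := Finset.sum_le_sum fun i (_ : i ∈ Finset.univ) => hsucc i
      rw [Finset.sum_add_distrib, Finset.sum_const, Finset.card_univ, Fintype.card_fin,
        smul_eq_mul] at h1
      calc _ ≤ (d + 1) ^ d + (d * (d + 1) ^ d + ∑ i, (coordProj i T).card) := by omega
        _ < (d + 1) ^ d + (d * (d + 1) ^ d + T.card) := by omega
        _ = (d + 1) ^ (d + 1) + T.card := by ring

/-! ### The game on the book graph -/

theorem bookGraph_adj_inl_inl {d n : ℕ} {i j : Fin d} (h : j ≠ i) :
    Sum.inl j ∈ (bookGraph d n).neighborSet (Sum.inl i) :=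
  ⟨fun h' => h (Sum.inl_injective h').symm, Or.inl rfl⟩

theorem bookGraph_adj_inl_inr {d n : ℕ} (i : Fin d) (j : Fin n) :
    Sum.inr j ∈ (bookGraph d n).neighborSet (Sum.inl i) :=
  ⟨Sum.inl_ne_inr, Or.inl rfl⟩

theorem bookGraph_adj_inr_inl {d n : ℕ} (j : Fin n) (i : Fin d) :
    Sum.inl i ∈ (bookGraph d n).neighborSet (Sum.inr j) :=
  ⟨Sum.inr_ne_inl, Or.inr rfl⟩

/-- If every function on spine colourings is used by some page, the spine colourings for which all
pages guess wrongly are fewer than the colours. -/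
theorem card_filter_forall_ne_lt {X : Type*} [Fintype X] {q n : ℕ} [Nonempty (Fin q)]
    {g : Fin n → X → Fin q} (hg : Function.Surjective g) (y : Fin n → Fin q) :
    (Finset.univ.filter fun x => ∀ j, g j x ≠ y j).card < q := by
  by_contra! hle
  set S := Finset.univ.filter fun x => ∀ j, g j x ≠ y j
  obtain ⟨e⟩ : Nonempty (Fin q ↪ S) :=
    Function.Embedding.nonempty_of_card_le (by simpa using hle)
  have he : Function.Injective fun a => (e a : X) := Subtype.val_injective.comp e.injective
  obtain ⟨j, hj⟩ := hg (Function.invFun fun a => (e a : X))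
  refine (Finset.mem_filter.1 (e (y j)).2).2 j ?_
  rw [hj]
  exact Function.leftInverse_invFun he (y j)

theorem hatWinnable_bookGraph {d n : ℕ}
    (hn : Fintype.card ((Fin d → Fin (1 + ∑ i ∈ Finset.Icc 1 d, i ^ i)) →
      Fin (1 + ∑ i ∈ Finset.Icc 1 d, i ^ i)) ≤ n) :
    HatWinnable (bookGraph d n) (1 + ∑ i ∈ Finset.Icc 1 d, i ^ i) := by
  classical
  set s := ∑ i ∈ Finset.Icc 1 d, i ^ i with hs
  have : Nonempty (Fin (1 + s)) := ⟨⟨0, by omega⟩⟩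
  obtain ⟨e⟩ : Nonempty (((Fin d → Fin (1 + s)) → Fin (1 + s)) ↪ Fin n) :=
    Function.Embedding.nonempty_of_card_le (by simpa using hn)
  obtain ⟨g, hg⟩ : ∃ g : Fin n → (Fin d → Fin (1 + s)) → Fin (1 + s), Function.Surjective g :=
    ⟨_, Function.invFun_surjective e.injective⟩
  have hguess : ∀ y : Fin n → Fin (1 + s),
      ∃ f : (i : Fin d) → ({j // j ≠ i} → Fin (1 + s)) → Fin (1 + s),
        ∀ x ∈ (Finset.univ.filter fun x => ∀ j, g j x ≠ y j), ∃ i, f i (fun j => x j) = x i := by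
    intro y
    refine exists_guess_of_card_le ?_
    have := card_filter_forall_ne_lt hg y
    rw [Fintype.card_fin]
    omega
  choose f hf using hguess
  refine ⟨fun v => match v with
    | Sum.inl i => fun c => f (fun j => c ⟨_, bookGraph_adj_inl_inr i j⟩) i
        fun j => c ⟨_, bookGraph_adj_inl_inl j.2⟩
    | Sum.inr j => fun c => g j fun i => c ⟨_, bookGraph_adj_inr_inl j i⟩, fun c => ?_⟩
  by_cases hpage : ∃ j, g j (fun i => c (Sum.inl i)) = c (Sum.inr j)
  · obtain ⟨j, hj⟩ := hpage
    exact ⟨Sum.inr j, hj⟩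
  · push Not at hpage
    obtain ⟨i, hi⟩ := hf (fun j => c (Sum.inr j)) (fun i => c (Sum.inl i))
      (Finset.mem_filter.2 ⟨Finset.mem_univ _, hpage⟩)
    exact ⟨Sum.inl i, hi⟩

theorem le_sum_pow_self (d : ℕ) : d ≤ ∑ i ∈ Finset.Icc 1 d, i ^ i := by
  calc d = ∑ i ∈ Finset.Icc 1 d, 1 := by simp
    _ ≤ _ := Finset.sum_le_sum fun i hi => Nat.one_le_pow _ _ (Finset.mem_Icc.1 hi).1

theorem not_hatWinnable_bookGraph {d n k : ℕ} (hk : 1 + ∑ i ∈ Finset.Icc 1 d, i ^ i < k) :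
    ¬ HatWinnable (bookGraph d n) k := by
  classical
  rintro ⟨f, hf⟩
  obtain ⟨T₀, hle, hcard, hlt⟩ := exists_sum_card_coordProj_lt d
  have hdk : d < k := by have := le_sum_pow_self d; omega
  -- Truncation only makes the map total; on `T₀` it changes no coordinate.
  set emb : (Fin d → ℕ) → Fin d → Fin k := fun x i => ⟨min (x i) d, by omega⟩ with hemb
  set T := T₀.image emb with hTdef
  have hinj : Set.InjOn emb T₀ := by
    intro x hx y hy hxy
    funext i
    have := congrArg Fin.val (congrFun hxy i)
    simpa [hemb, hle x hx i, hle y hy i] using this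
  have hTcard : T.card = T₀.card := Finset.card_image_of_injOn hinj
  have hproj : ∀ i, (coordProj i T).card ≤ (coordProj i T₀).card := by
    intro i
    have : coordProj i T = (coordProj i T₀).image
        fun z j => (⟨min (z j) d, by omega⟩ : Fin k) := by
      simp only [coordProj, hTdef, Finset.image_image]
      rfl
    rw [this]
    exact Finset.card_image_le
  have hT : ∑ i, (coordProj i T).card < T.card :=
    hTcard ▸ (Finset.sum_le_sum fun i _ => hproj i).trans_lt hlt
  have hpage : ∀ j : Fin n, ∃ a : Fin k, ∀ x ∈ T,
      f (Sum.inr j) (fun w => Sum.elim x (fun _ => a) w.1) ≠ a := by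
    intro j
    have hcol : ∀ (w : (bookGraph d n).neighborSet (Sum.inr j)), w.1.isLeft = true := by
      rintro ⟨w, hw⟩
      exact hw.2.resolve_left (by simp)
    obtain ⟨a, ha⟩ : ∃ a, a ∉ T.image fun x =>
        f (Sum.inr j) (fun w => x (w.1.getLeft (hcol w))) := by
      by_contra! hall
      have h1 := Finset.card_le_card (fun a _ => hall a : Finset.univ ⊆ _)
      have h2 := h1.trans Finset.card_image_le
      rw [Finset.card_univ, Fintype.card_fin] at h2
      omega
    refine ⟨a, fun x hx h => ha (Finset.mem_image.2 ⟨x, hx, ?_⟩)⟩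
    rw [← h]
    congr 1
    funext ⟨w, hw⟩
    rcases w with i | i
    · rfl
    · exact absurd (hcol ⟨_, hw⟩) (by simp)
  choose y hy using hpage
  obtain ⟨x, hx, hxg⟩ := exists_forall_guess_ne hT fun i z =>
    -- The value `0` is never read, since no vertex is its own neighbour.
    f (Sum.inl i) fun w => Sum.elim (fun j => if h : j = i then ⟨0, by omega⟩ else z ⟨j, h⟩) y w.1
  obtain ⟨v, hv⟩ := hf (Sum.elim x y)
  rcases v with i | j
  · refine hxg i (Eq.trans ?_ hv)
    congr 1
    funext ⟨w, hw⟩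
    rcases w with j | j
    · have hji : j ≠ i := fun h => hw.1 (by rw [h])
      simp [hji]
    · rfl
  · refine hy j x hx (Eq.trans ?_ hv)
    congr 1
    funext ⟨w, hw⟩
    rcases w with i | i
    · rfl
    · exact absurd (hw.2) (by simp)

/-! ### The vertex cover number and the conclusion -/

theorem vertexCoverNum_bookGraph {d n : ℕ} (hn : 1 ≤ n) :
    (bookGraph d n).vertexCoverNum = d := by
  apply le_antisymm
  · have hcover : (bookGraph d n).IsVertexCover (Set.range Sum.inl) := by
      rintro (i | i) (j | j) h
      · exact Or.inl ⟨i, rfl⟩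
      · exact Or.inl ⟨i, rfl⟩
      · exact Or.inr ⟨j, rfl⟩
      · exact absurd h.2 (by simp)
    refine hcover.vertexCoverNum_le.trans_eq ?_
    rw [← Set.image_univ, Sum.inl_injective.encard_image, Set.encard_univ]
    simp
  · obtain ⟨s, hs, hcover⟩ := (bookGraph d n).vertexCoverNum_exists
    rw [← hs]
    by_cases hall : ∀ i : Fin d, Sum.inl i ∈ s
    · calc (d : ℕ∞) = (Set.range (Sum.inl : Fin d → Fin d ⊕ Fin n)).encard := by
            rw [← Set.image_univ, Sum.inl_injective.encard_image, Set.encard_univ]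
            simp
        _ ≤ s.encard := Set.encard_le_encard (Set.range_subset_iff.2 hall)
    · push Not at hall
      obtain ⟨i, hi⟩ := hall
      -- A cover missing spine vertex `i` contains all its neighbours: the other spine vertices and
      -- a page, `d` in all.
      set e : Fin d → Fin d ⊕ Fin n := fun j => if j = i then Sum.inr ⟨0, hn⟩ else Sum.inl j
      have he : Function.Injective e := by
        intro a b hab
        by_cases ha : a = i <;> by_cases hb : b = i <;> simp_all [e]
      calc (d : ℕ∞) = (Set.range e).encard := by
            rw [← Set.image_univ, he.encard_image, Set.encard_univ]
            simp
        _ ≤ s.encard := Set.encard_le_encard <| Set.range_subset_iff.2 fun j => by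
            refine (hcover (v := Sum.inl i) (w := e j) ⟨?_, Or.inl rfl⟩).resolve_left hi
            by_cases hj : j = i
            · simp [e, hj]
            · simpa [e, hj] using Ne.symm hj

theorem theorem1 (d : ℕ) (hd : 1 ≤ d) :
    ∃ N : ℕ, ∀ n : ℕ, N ≤ n →
      IsHatGuessingNumber (bookGraph d n) (1 + ∑ i ∈ Finset.Icc 1 d, i ^ i) ∧
      (bookGraph d n).vertexCoverNum = d := by
  refine ⟨max 1 (Fintype.card ((Fin d → Fin (1 + ∑ i ∈ Finset.Icc 1 d, i ^ i)) →
      Fin (1 + ∑ i ∈ Finset.Icc 1 d, i ^ i))), fun n hn => ⟨⟨?_, fun k hk => ?_⟩, ?_⟩⟩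
  · exact hatWinnable_bookGraph ((le_max_right _ _).trans hn)
  · by_contra! hlt
    exact not_hatWinnable_bookGraph hlt hk
  · exact vertexCoverNum_bookGraph ((le_max_left _ _).trans hn)
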